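/- Let $\mathcal X$ be a separable metric space with at least two points, let $\Omega=\mathcal X^{\infty}$ be the set of infinite sequences (paths) in $\mathcal X$ with the product topology, and let $\Sigma$ be a $\sigma$-algebra on $\Omega$ that contains all open sets; its members are called events. For $\omega\in\Omega$ and $t\ge 0$ let $\omega^{t}\subseteq\Omega$ be the cylinder of all paths that coincide with $\omega$ in the first $t$ periods (so $\omega^{0}=\Omega$), and let $\mathcal H$ be the set of all cylinders. A conditional probability is a function $P\colon\Sigma\times\mathcal H\to[0,1]$ such that for all $\omega\in\Omega$ and $t,n\ge 0$: (1) $P(\cdot\mid\omega^{t})$ is a finitely additive probability on $(\Omega,\Sigma)$; (2) $P(\omega^{t}\mid\omega^{t})=1$; (3) $P(E\cap\omega^{t+n}\mid\omega^{t})=P(E\mid\omega^{t+n})\,P(\omega^{t+n}\mid\omega^{t})$ for every event $E$. It is a conditional opinion if $P(\cdot\mid\Omega)$ is strongly nonatomic, i.e. for every event $E$ and every $\alpha\in[0,1]$ there is an event $F\subseteq E$ with $P(F\mid\Omega)=\alpha P(E\mid\Omega)$. Let $\Delta^{*}$ be the set of all conditional opinions. A test is a function $T$ that maps each $P\in\Delta^{*}$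 to an open subset $T(P)$ of $\Omega$. For $\varepsilon\in[0,1)$, the test $T$ $\Delta^{*}$-controls for type I error with probability $1-\varepsilon$ if $P(T(P)\mid\Omega)\le\varepsilon$ for every $P\in\Delta^{*}$. For $q\in[0,1]$, the test $T$ can be manipulated with probability $q$ if there is a probability measure $\zeta$ with finite support on $\Delta^{*}$ such that $\zeta(\{P\in\Delta^{*}:\omega\notin T(P)\})\ge q$ for every $\omega\in\Omega$. Theorem. Let $\varepsilon\in[0,1)$ and let $T$ be a test that $\Delta^{*}$-controls for type I error with probability $1-\varepsilon$. Then $T$ can be manipulated with probability $1-\varepsilon-\delta$, for every $\delta\in(0,1-\varepsilon]$. -/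

import Mathlib

noncomputable section

namespace OpinionTest

open Set TopologicalSpace

/-- The set `Ω = X^∞` of paths; it carries the product topology. -/
abbrev Path (X : Type*) : Type _ := ℕ → X

/-- The events: the members of the `σ`-algebra `Σ` of `Ω`. -/
abbrev Event (Ω : Type*) [MeasurableSpace Ω] : Type _ := {E : Set Ω // MeasurableSet E}

/-- Finitely additive probabilities on `(Ω, Σ)`. -/
@[ext]
structure FinAddProb (Ω : Type*) [MeasurableSpace Ω] where
  /-- the probability of an event -/
  prob : Event Ω → ℝ
  nonneg : ∀ E, 0 ≤ prob E
  prob_univ : prob ⟨univ, MeasurableSet.univ⟩ = 1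
  prob_union : ∀ E F : Event Ω, Disjoint E.1 F.1 →
    prob ⟨E.1 ∪ F.1, E.2.union F.2⟩ = prob E + prob F

/-- Strong nonatomicity: every event `E` and `α ∈ [0,1]` admit an event `F ⊆ E` with
`P F = α P E`. -/
def FinAddProb.StronglyNonatomic {Ω : Type*} [MeasurableSpace Ω] (P : FinAddProb Ω) : Prop :=
  ∀ (E : Event Ω) (α : ℝ), 0 ≤ α → α ≤ 1 →
    ∃ F : Event Ω, F.1 ⊆ E.1 ∧ P.prob F = α * P.prob E

/-- The set `H` of cylinders `ω^t` (all paths that agree with `ω` in the first `t` periods).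
Cylinders are sets: `ω^t` and `η^t` are the same cylinder if `ω` and `η` agree in the first
`t` periods. -/
abbrev Cyl (X : Type*) : Type _ :=
  {C : Set (Path X) // ∃ (ω : Path X) (t : ℕ), PiNat.cylinder ω t = C}

/-- The cylinder `ω^t`. -/
def cyl {X : Type*} (ω : Path X) (t : ℕ) : Cyl X := ⟨PiNat.cylinder ω t, ω, t, rfl⟩

/-- The whole space `Ω = ω^0` as a cylinder. -/
def wholeCyl (X : Type*) [Nonempty X] : Cyl X :=
  ⟨univ, Classical.arbitrary _, 0, PiNat.cylinder_zero _⟩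

section

variable {X : Type*} [MetricSpace X] [MeasurableSpace (Path X)] [OpensMeasurableSpace (Path X)]

/-- Cylinders are closed, hence events as soon as `Σ` contains the open sets. -/
theorem measurableSet_cylinder (ω : Path X) (t : ℕ) : MeasurableSet (PiNat.cylinder ω t) := by
  have h : IsClosed (PiNat.cylinder ω t) := by
    simp only [PiNat.cylinder_eq_pi]
    exact isClosed_set_pi fun i _ => isClosed_singleton
  exact h.measurableSet

/-- The cylinder `ω^t` as an event. -/
def cylEvent (ω : Path X) (t : ℕ) : Event (Path X) :=
  ⟨PiNat.cylinder ω t, measurableSet_cylinder ω t⟩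

/-- An open set as an event. -/
def openEvent (U : Opens (Path X)) : Event (Path X) := ⟨U, U.isOpen.measurableSet⟩

end

section

variable (X : Type*) [MetricSpace X] [MeasurableSpace (Path X)] [OpensMeasurableSpace (Path X)]

/-- Conditional probabilities: `(cond C).prob E` is `P (E | C)`. -/
@[ext]
structure CondProb where
  /-- `P (· | C)`, a finitely additive probability for every cylinder `C` -/
  cond : Cyl X → FinAddProb (Path X)
  cond_self : ∀ (ω : Path X) (t : ℕ), (cond (cyl ω t)).prob (cylEvent ω t) = 1
  cond_chain : ∀ (ω : Path X) (t n : ℕ) (E : Event (Path X)),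
    (cond (cyl ω t)).prob
        ⟨E.1 ∩ PiNat.cylinder ω (t + n), E.2.inter (measurableSet_cylinder ω (t + n))⟩ =
      (cond (cyl ω (t + n))).prob E * (cond (cyl ω t)).prob (cylEvent ω (t + n))

variable [Nonempty X]

/-- Conditional opinions: conditional probabilities `P` such that `P (· | Ω)` is strongly
nonatomic. -/
@[ext]
structure CondOpinion extends CondProb X where
  nonatomic : (cond (wholeCyl X)).StronglyNonatomic

/-- The unconditional part `P (· | Ω)` of a conditional opinion. -/
def CondOpinion.uncond {X : Type*} [MetricSpace X] [MeasurableSpace (Path X)]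
    [OpensMeasurableSpace (Path X)] [Nonempty X] (P : CondOpinion X) : FinAddProb (Path X) :=
  P.cond (wholeCyl X)

/-- A test maps every conditional opinion `P` to an open set `T P` of paths; an expert who
announces `P` is rejected on the paths in `T P`. -/
abbrev Test : Type _ := CondOpinion X → Opens (Path X)

/-- A strategy: a probability measure with finite support on the set of conditional opinions,
given by its point masses. -/
structure Strategy where
  /-- the point masses -/
  weight : CondOpinion X →₀ ℝ
  weight_nonneg : ∀ P, 0 ≤ weight P
  weight_total : ∑ P ∈ weight.support, weight P = 1

end

section

variable {X : Type*} [MetricSpace X] [MeasurableSpace (Path X)] [OpensMeasurableSpace (Path X)]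
  [Nonempty X]

open Classical in
/-- The probability that the strategy `ζ` gives to a set `S` of conditional opinions. -/
def Strategy.prob (ζ : Strategy X) (S : Set (CondOpinion X)) : ℝ :=
  ∑ P ∈ ζ.weight.support with P ∈ S, ζ.weight P

/-- `T` `Λ`-controls for type I error with probability `1 - ε`. -/
def Test.ControlsTypeI (T : Test X) (Λ : Set (CondOpinion X)) (ε : ℝ) : Prop :=
  ∀ P ∈ Λ, P.uncond.prob (openEvent (T P)) ≤ ε

/-- `T` can be manipulated with probability `q`. -/
def Test.CanBeManipulated (T : Test X) (q : ℝ) : Prop :=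
  ∃ ζ : Strategy X, ∀ ω : Path X, q ≤ ζ.prob {P | ω ∉ T P}

end

end OpinionTest

end

/-!
Fix countably many paths, no two of which eventually agree, indexed by the rationals, and let `A t`
be the event that the path eventually agrees with one of those of index below `t`. The charges
`m` with `m (A t) = t` for `t ∈ [0, 1]` form a compact convex set `K`, and by the intermediate value
theorem applied to `t ↦ m (E ∩ A t)` each of them is strongly nonatomic. Each of them also extends
to a conditional opinion: condition on the cylinders of positive probability, and give every null
cylinder the point mass at its least element for a fixed well-order of the paths. Control of type
I error therefore makes `sup_P m (T P)ᶜ` larger than `1 - ε - δ` on all of `K`, and the minimax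
theorem produces a finitely supported `ζ` with `∑ ζ(P) m (T P)ᶜ > 1 - ε - δ` for all `m ∈ K`.

The events `A t` do not depend on any finite set of coordinates, so for every path `ω` some `m ∈ K`
gives probability one to every neighbourhood of `ω`. As `T P` is open, `m (T P)ᶜ` vanishes for this
`m` when `ω ∈ T P`, so that the inequality for `m` bounds `ζ {P | ω ∉ T P}` from below.
-/

noncomputable section

namespace OpinionTest

open Filter Set Topology

section Minimax

theorem exists_finset_forall_exists_lt {E ι : Type*} [TopologicalSpace E] {K : Set E}
    (hK : IsCompact K) {g : ι → E → ℝ} (hg : ∀ i, LowerSemicontinuousOn (g i) K) {c : ℝ}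
    (hlt : ∀ x ∈ K, ∃ i, c < g i x) :
    ∃ s : Finset ι, ∀ x ∈ K, ∃ i ∈ s, c < g i x := by
  refine hK.induction_on (p := fun t => ∃ s : Finset ι, ∀ x ∈ t, ∃ i ∈ s, c < g i x)
    ⟨∅, by simp⟩ (fun t u htu ⟨s, hs⟩ => ⟨s, fun x hx => hs x (htu hx)⟩) ?_ ?_
  · classical
    rintro t u ⟨s, hs⟩ ⟨r, hr⟩
    refine ⟨s ∪ r, ?_⟩
    rintro x (hx | hx)
    · obtain ⟨i, hi, h⟩ := hs x hx
      exact ⟨i, Finset.mem_union_left _ hi, h⟩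
    · obtain ⟨i, hi, h⟩ := hr x hx
      exact ⟨i, Finset.mem_union_right _ hi, h⟩
  · intro x hx
    obtain ⟨i, hi⟩ := hlt x hx
    exact ⟨_, hg i x hx c hi, {i}, fun z hz => ⟨i, Finset.mem_singleton_self i, hz⟩⟩

variable {E ι : Type*} [AddCommGroup E] [Module ℝ E]

theorem convexOn_sum_mul [Fintype ι] {K : Set E} (hK : Convex ℝ K) {g : ι → E → ℝ}
    (hg : ∀ i, ConvexOn ℝ K (g i)) {w : ι → ℝ} (hw : ∀ i, 0 ≤ w i) :
    ConvexOn ℝ K fun x => ∑ i, w i * g i x := by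
  have h := Finset.sum_induction (s := Finset.univ) (fun i x => w i * g i x) (ConvexOn ℝ K)
    (fun _ _ => .add) (convexOn_const 0 hK) fun i _ => (hg i).smul (hw i)
  exact h.congr fun x _ => Finset.sum_apply _ _ _

variable [TopologicalSpace E] [IsTopologicalAddGroup E] [ContinuousSMul ℝ E]

theorem exists_mem_stdSimplex_forall_lt_sum [Fintype ι] {K : Set E} (hKconv : Convex ℝ K)
    (hKcomp : IsCompact K) (hKne : K.Nonempty) {g : ι → E → ℝ}
    (hgconv : ∀ i, ConvexOn ℝ K (g i)) (hgcont : ∀ i, LowerSemicontinuousOn (g i) K) {c : ℝ}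
    (hlt : ∀ x ∈ K, ∃ i, c < g i x) :
    ∃ w ∈ stdSimplex ℝ ι, ∀ x ∈ K, c < ∑ i, w i * g i x := by
  classical
  let f : E → (ι → ℝ) → ℝ := fun x w => ∑ i, w i * g i x
  have hf_single (x : E) (i : ι) : f x (Pi.single i 1) = g i x := by
    simp [f, Pi.single_apply]
  have hf_lsc : ∀ w ∈ stdSimplex ℝ ι, LowerSemicontinuousOn (fun x => f x w) K := fun w hw =>
    lowerSemicontinuousOn_sum fun i _ => (continuous_const_mul (w i)).comp_lowerSemicontinuousOn
      (hgcont i) (monotone_mul_left_of_nonneg (hw.1 i))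
  have hf_convex : ∀ w ∈ stdSimplex ℝ ι, ConvexOn ℝ K fun x => f x w := fun w hw =>
    convexOn_sum_mul hKconv hgconv hw.1
  have hf_concave (x : E) : ConcaveOn ℝ (stdSimplex ℝ ι) (f x) :=
    (Fintype.linearCombination ℝ fun i => g i x).concaveOn (convex_stdSimplex ℝ ι)
  have hf_cont (x : E) : Continuous (f x) := by fun_prop
  obtain ⟨x₀, hx₀⟩ := hKne
  obtain ⟨i₀, -⟩ := hlt x₀ hx₀
  obtain ⟨a, ha, w, hw, hsaddle⟩ := Sion.exists_isSaddlePointOn (f := f) ⟨x₀, hx₀⟩ hKconv hKcomp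
    hf_lsc (fun w hw => (hf_convex w hw).quasiconvexOn) (convex_stdSimplex ℝ ι)
    ⟨_, single_mem_stdSimplex ℝ i₀⟩ (isCompact_stdSimplex ℝ ι)
    (fun x _ => (hf_cont x).upperSemicontinuous.upperSemicontinuousOn _)
    (fun x _ => (hf_concave x).quasiconcaveOn)
  obtain ⟨i, hi⟩ := hlt a ha
  exact ⟨w, hw, fun x hx => (hf_single a i ▸ hi).trans_le
    (hsaddle x hx _ (single_mem_stdSimplex ℝ i))⟩

theorem exists_finsupp_forall_lt_sum {K : Set E} (hKconv : Convex ℝ K)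
    (hKcomp : IsCompact K) (hKne : K.Nonempty) {g : ι → E → ℝ}
    (hgconv : ∀ i, ConvexOn ℝ K (g i)) (hgcont : ∀ i, LowerSemicontinuousOn (g i) K) {c : ℝ}
    (hlt : ∀ x ∈ K, ∃ i, c < g i x) :
    ∃ w : ι →₀ ℝ, (∀ i, 0 ≤ w i) ∧ (w.sum fun _ a => a) = 1 ∧
      ∀ x ∈ K, c < w.sum fun i a => a * g i x := by
  classical
  obtain ⟨s, hs⟩ := exists_finset_forall_exists_lt hKcomp hgcont hlt
  obtain ⟨w, hw, hlt_w⟩ := exists_mem_stdSimplex_forall_lt_sum hKconv hKcomp hKne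
    (fun i : s => hgconv i) (fun i => hgcont i) (by simpa using hs)
  refine ⟨(Finsupp.equivFunOnFinite.symm w).embDomain (.subtype _), fun j => ?_, ?_, ?_⟩
  · rw [Finsupp.embDomain_apply]
    split_ifs
    exacts [hw.1 _, le_rfl]
  · rw [Finsupp.sum_embDomain, Finsupp.sum_fintype _ _ fun _ => rfl]
    exact hw.2
  · intro x hx
    rw [Finsupp.sum_embDomain, Finsupp.sum_fintype _ _ fun _ => zero_mul _]
    exact hlt_w x hx

end Minimax

theorem exists_selector_eq_of_subset (Ω : Type*) [Nonempty Ω] : ∃ b : Set Ω → Ω,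
    (∀ C, C.Nonempty → b C ∈ C) ∧ ∀ C D, D ⊆ C → b C ∈ D → b D = b C := by
  obtain ⟨_, _⟩ := exists_wellFoundedLT Ω
  have hleast : ∀ C : Set Ω, C.Nonempty → ∃ x, IsLeast C x := fun C hC =>
    let ⟨x, hx, hmin⟩ := wellFounded_lt.has_min C hC
    ⟨x, hx, fun y hy => not_lt.1 (hmin y hy)⟩
  choose! b hb using hleast
  exact ⟨b, fun C hC => (hb C hC).1, fun C D hDC hD =>
    (hb D ⟨_, hD⟩).unique ⟨hD, fun y hy => (hb C ⟨y, hDC hy⟩).2 (hDC hy)⟩⟩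

section Charges

variable {Ω : Type*} [MeasurableSpace Ω]

namespace FinAddProb

variable (m : FinAddProb Ω)

theorem prob_top : m.prob ⊤ = 1 := m.prob_univ

theorem prob_sdiff {E F : Event Ω} (h : E ≤ F) : m.prob (F \ E) = m.prob F - m.prob E := by
  have hdisj : Disjoint E.1 (F \ E : Event Ω).1 := disjoint_sdiff_right
  have hunion : E ∪ F \ E = F := Subtype.ext (union_sdiff_cancel h)
  have hadd : m.prob (E ∪ F \ E) = m.prob E + m.prob (F \ E) := m.prob_union E (F \ E) hdisj
  rw [hunion] at hadd
  linarith

theorem mono : Monotone m.prob := fun E F h => by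
  linarith [m.nonneg (F \ E), m.prob_sdiff h]

theorem prob_compl (E : Event Ω) : m.prob Eᶜ = 1 - m.prob E := by
  rw [← m.prob_top, ← m.prob_sdiff le_top]
  exact congrArg m.prob (Subtype.ext (compl_eq_univ_sdiff E.1))

theorem prob_le_one (E : Event Ω) : m.prob E ≤ 1 :=
  m.prob_top ▸ m.mono le_top

theorem prob_inter_sub_prob_inter_le (E : Event Ω) {A B : Event Ω} (h : A ≤ B) :
    m.prob (E ∩ B) - m.prob (E ∩ A) ≤ m.prob B - m.prob A := by
  have hEAB : E ∩ A ≤ E ∩ B := inter_subset_inter_right E.1 h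
  rw [← m.prob_sdiff hEAB, ← m.prob_sdiff h]
  exact m.mono fun _ hx => ⟨hx.1.2, fun hA => hx.2 ⟨hx.1.1, hA⟩⟩

/-- `m` is uniform along the family `A` of events if it turns the parameter into the uniform
distribution on `[0, 1]`: `A t` has probability `t`. -/
def IsUniformAlong (A : ℝ → Event Ω) : Prop :=
  ∀ t ∈ Icc (0 : ℝ) 1, m.prob (A t) = t

variable {m}

theorem IsUniformAlong.lipschitzOnWith {A : ℝ → Event Ω} (hm : m.IsUniformAlong A)
    (hA : Monotone A) (E : Event Ω) :
    LipschitzOnWith 1 (fun t => m.prob (E ∩ A t)) (Icc 0 1) := by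
  refine LipschitzOnWith.of_le_add fun s hs t ht => ?_
  rcases le_total s t with hst | hts
  · exact (m.mono (inter_subset_inter_right E.1 (hA hst))).trans
      (le_add_of_nonneg_right dist_nonneg)
  · have h := m.prob_inter_sub_prob_inter_le E (hA hts)
    rw [hm s hs, hm t ht] at h
    exact sub_le_iff_le_add'.1 (h.trans (le_abs_self _))

theorem IsUniformAlong.stronglyNonatomic {A : ℝ → Event Ω} (hm : m.IsUniformAlong A)
    (hA : Monotone A) : m.StronglyNonatomic := by
  intro E α hα₀ hα₁
  have h₀ : m.prob (E ∩ A 0) ≤ 0 :=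
    (m.mono inter_subset_right).trans (hm 0 (left_mem_Icc.2 zero_le_one)).le
  have h₁ : m.prob E ≤ m.prob (E ∩ A 1) := by
    have h := m.prob_inter_sub_prob_inter_le E (le_top : A 1 ≤ ⊤)
    have hE : E ∩ ⊤ = E := Subtype.ext (inter_univ E.1)
    rw [hm 1 (right_mem_Icc.2 zero_le_one), m.prob_top, hE] at h
    linarith
  obtain ⟨t, -, ht⟩ := intermediate_value_Icc zero_le_one (hm.lipschitzOnWith hA E).continuousOn
    (show α * m.prob E ∈ Icc _ _ from ⟨h₀.trans (mul_nonneg hα₀ (m.nonneg E)),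
      (mul_le_of_le_one_left (m.nonneg E) hα₁).trans h₁⟩)
  exact ⟨E ∩ A t, inter_subset_left, ht⟩

theorem mem_range_prob_iff {f : Event Ω → ℝ} :
    f ∈ range FinAddProb.prob ↔ (∀ E, 0 ≤ f E) ∧ f ⊤ = 1 ∧
      ∀ E F : Event Ω, Disjoint E.1 F.1 → f (E ∪ F) = f E + f F :=
  ⟨fun ⟨m, hm⟩ => hm ▸ ⟨m.nonneg, m.prob_univ, m.prob_union⟩,
    fun ⟨h₀, h₁, hadd⟩ => ⟨⟨f, h₀, h₁, hadd⟩, rfl⟩⟩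

theorem isClosed_range_prob : IsClosed (range (FinAddProb.prob (Ω := Ω))) := by
  have h : range (FinAddProb.prob (Ω := Ω)) = {f | (∀ E, 0 ≤ f E) ∧ f ⊤ = 1 ∧
      ∀ E F : Event Ω, Disjoint E.1 F.1 → f (E ∪ F) = f E + f F} :=
    Set.ext fun _ => mem_range_prob_iff
  simp only [h, ofPred_and, ofPred_forall]
  refine .inter (isClosed_iInter fun E => isClosed_le (by fun_prop) (by fun_prop)) <|
    .inter (isClosed_eq (by fun_prop) (by fun_prop)) <| isClosed_iInter fun E =>
      isClosed_iInter fun F => isClosed_iInter fun _ => isClosed_eq (by fun_prop) (by fun_prop)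

theorem isCompact_range_prob : IsCompact (range (FinAddProb.prob (Ω := Ω))) := by
  refine (isCompact_univ_pi fun _ => isCompact_Icc (a := (0 : ℝ)) (b := 1)).of_isClosed_subset
    isClosed_range_prob ?_
  rintro _ ⟨m, rfl⟩ E -
  exact ⟨m.nonneg E, m.prob_le_one E⟩

theorem convex_range_prob : Convex ℝ (range (FinAddProb.prob (Ω := Ω))) := by
  rintro _ ⟨p, rfl⟩ _ ⟨q, rfl⟩ a b ha hb hab
  refine mem_range_prob_iff.2 ⟨fun E => ?_, ?_, fun E F h => ?_⟩
  · exact add_nonneg (mul_nonneg ha (p.nonneg E)) (mul_nonneg hb (q.nonneg E))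
  · simp [prob_top, hab]
  · have hp : p.prob (E ∪ F) = p.prob E + p.prob F := p.prob_union E F h
    have hq : q.prob (E ∪ F) = q.prob E + q.prob F := q.prob_union E F h
    simp only [Pi.add_apply, Pi.smul_apply, smul_eq_mul, hp, hq]
    ring

theorem exists_forall_tendsto {ι : Type*} (U : Ultrafilter ι) (p : ι → FinAddProb Ω) :
    ∃ m : FinAddProb Ω, ∀ E, Tendsto (fun i => (p i).prob E) U (𝓝 (m.prob E)) := by
  obtain ⟨_, ⟨m, rfl⟩, hm⟩ := isCompact_range_prob.ultrafilter_le_nhds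
    (U.map fun i => (p i).prob) (le_principal_iff.2 (mem_map.2 (univ_mem' fun i => ⟨p i, rfl⟩)))
  exact ⟨m, tendsto_pi_nhds.1 hm⟩

theorem exists_finsupp_forall_isUniformAlong_lt_sum {ι : Type*} {A : ℝ → Event Ω}
    {E : ι → Event Ω} {c : ℝ} (hne : ∃ m : FinAddProb Ω, m.IsUniformAlong A)
    (hlt : ∀ m : FinAddProb Ω, m.IsUniformAlong A → ∃ i, c < m.prob (E i)) :
    ∃ w : ι →₀ ℝ, (∀ i, 0 ≤ w i) ∧ (w.sum fun _ a => a) = 1 ∧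
      ∀ m : FinAddProb Ω, m.IsUniformAlong A → c < w.sum fun i a => a * m.prob (E i) := by
  let S : Set (Event Ω → ℝ) := {f | ∀ t ∈ Icc (0 : ℝ) 1, f (A t) = t}
  have hSclosed : IsClosed S := by
    simp only [S, ofPred_forall]
    exact isClosed_iInter fun t => isClosed_iInter fun _ =>
      isClosed_eq (by fun_prop) (by fun_prop)
  have hSconv : Convex ℝ S := fun f hf g hg a b _ _ hab t ht => by
    simp [hf t ht, hg t ht, ← add_mul, hab]
  obtain ⟨m₀, hm₀⟩ := hne
  obtain ⟨w, hw, hw_sum, hw_lt⟩ := exists_finsupp_forall_lt_sum (g := fun i f => f (E i)) (c := c)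
    (convex_range_prob.inter hSconv) (isCompact_range_prob.inter_right hSclosed)
    ⟨m₀.prob, ⟨m₀, rfl⟩, hm₀⟩
    (fun i => (LinearMap.proj (E i)).convexOn (convex_range_prob.inter hSconv))
    (fun i => (continuous_apply (E i)).lowerSemicontinuous.lowerSemicontinuousOn _)
    (by rintro _ ⟨⟨m, rfl⟩, hm⟩; exact hlt m hm)
  exact ⟨w, hw, hw_sum, fun m hm => hw_lt m.prob ⟨⟨m, rfl⟩, hm⟩⟩

theorem prob_eq_zero_of_le {E F : Event Ω} (h : E ≤ F) (hF : m.prob F = 0) : m.prob E = 0 :=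
  le_antisymm ((m.mono h).trans hF.le) (m.nonneg E)

/-- The conditional of `m` on an event of nonzero probability. -/
def condOn (C : Event Ω) (hC : m.prob C ≠ 0) : FinAddProb Ω where
  prob E := m.prob (E ∩ C) / m.prob C
  nonneg E := div_nonneg (m.nonneg _) (m.nonneg _)
  prob_univ := by
    have h : (⊤ : Event Ω) ∩ C = C := Subtype.ext (univ_inter C.1)
    exact (congrArg (m.prob · / m.prob C) h).trans (div_self hC)
  prob_union E F h := by
    have hEF : (E ∪ F) ∩ C = E ∩ C ∪ F ∩ C := Subtype.ext (union_inter_distrib_right _ _ _)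
    have hdisj : Disjoint (E ∩ C : Event Ω).1 (F ∩ C : Event Ω).1 :=
      h.mono inter_subset_left inter_subset_left
    rw [← add_div, ← m.prob_union (E ∩ C) (F ∩ C) hdisj]
    exact congrArg (m.prob · / m.prob C) hEF

/-- The point mass at `x`. -/
def dirac (x : Ω) : FinAddProb Ω where
  prob E := E.1.indicator 1 x
  nonneg _ := indicator_nonneg (fun _ _ => zero_le_one) x
  prob_univ := by simp
  prob_union E F h := by rw [indicator_union_of_disjoint h]

theorem condOn_top (h : m.prob ⊤ ≠ 0) : m.condOn ⊤ h = m := by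
  ext E
  have hE : E ∩ ⊤ = E := Subtype.ext (inter_univ E.1)
  simp only [condOn, prob_top, hE, div_one]

theorem condOn_prob_inter {C D : Event Ω} (hC : m.prob C ≠ 0) (hD : m.prob D ≠ 0) (hDC : D ≤ C)
    (E : Event Ω) :
    (m.condOn C hC).prob (E ∩ D) = (m.condOn D hD).prob E * (m.condOn C hC).prob D := by
  have hD_inter : D ∩ C = D := Subtype.ext (inter_eq_left.2 hDC)
  have hED_inter : (E ∩ D) ∩ C = E ∩ D := Subtype.ext (inter_eq_left.2 fun _ hx => hDC hx.2)
  simp only [condOn, hD_inter, hED_inter]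
  field_simp

theorem dirac_prob_inter {x y : Ω} {D : Event Ω} (h : x ∈ D.1 → y = x) (E : Event Ω) :
    (dirac x).prob (E ∩ D) = (dirac y).prob E * (dirac x).prob D := by
  classical
  change (E.1 ∩ D.1).indicator 1 x = E.1.indicator 1 y * D.1.indicator 1 x
  by_cases hD : x ∈ D.1 <;> simp [indicator_apply, hD, h]

theorem exists_full_conditional [Nonempty Ω] (m : FinAddProb Ω) :
    ∃ κ : Event Ω → FinAddProb Ω, κ ⊤ = m ∧ (∀ C, C.1.Nonempty → (κ C).prob C = 1) ∧
      ∀ C D E, D ≤ C → (κ C).prob (E ∩ D) = (κ D).prob E * (κ C).prob D := by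
  classical
  obtain ⟨b, hb_mem, hb_eq⟩ := exists_selector_eq_of_subset Ω
  let κ : Event Ω → FinAddProb Ω := fun C =>
    if hC : m.prob C = 0 then dirac (b C.1) else m.condOn C hC
  have hκ_null {C : Event Ω} (hC : m.prob C = 0) : κ C = dirac (b C.1) := dif_pos hC
  have hκ_pos {C : Event Ω} (hC : m.prob C ≠ 0) : κ C = m.condOn C hC := dif_neg hC
  refine ⟨κ, ?_, fun C hC => ?_, fun C D E hDC => ?_⟩
  · rw [hκ_pos (m.prob_top ▸ one_ne_zero), condOn_top]
  · by_cases hC₀ : m.prob C = 0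
    · rw [hκ_null hC₀]
      exact indicator_of_mem (hb_mem C.1 hC) _
    · have hCC : C ∩ C = C := Subtype.ext (inter_self C.1)
      rw [hκ_pos hC₀]
      simp only [condOn, hCC, div_self hC₀]
  · by_cases hC₀ : m.prob C = 0
    · rw [hκ_null hC₀, hκ_null (prob_eq_zero_of_le hDC hC₀)]
      exact dirac_prob_inter (hb_eq C.1 D.1 hDC) E
    · rw [hκ_pos hC₀]
      by_cases hD₀ : m.prob D = 0
      · have hD_inter : m.prob (D ∩ C) = 0 := prob_eq_zero_of_le (inter_subset_left) hD₀
        have hED : m.prob (E ∩ D ∩ C) = 0 := prob_eq_zero_of_le (fun _ hx => hx.1.2) hD₀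
        simp only [condOn, hD_inter, hED, zero_div, mul_zero]
      · rw [hκ_pos hD₀, condOn_prob_inter hC₀ hD₀ hDC]

/-- The uniform distribution on the points `x i` with `i ∈ s`, counted with multiplicity. -/
def empirical {ι : Type*} (s : Finset ι) (hs : s.Nonempty) (x : ι → Ω) : FinAddProb Ω where
  prob E := (∑ i ∈ s, E.1.indicator 1 (x i)) / s.card
  nonneg E := div_nonneg (Finset.sum_nonneg fun _ _ => indicator_nonneg (fun _ _ => zero_le_one) _)
    (Nat.cast_nonneg _)
  prob_univ := by simp [hs.card_ne_zero]
  prob_union E F h := by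
    simp only [indicator_union_of_disjoint h, Finset.sum_add_distrib, add_div]

end FinAddProb

end Charges

section Paths

variable {X : Type*}

/-- The path that follows `ω` in the first `n` periods and `y` afterwards. -/
def splice (ω y : Path X) (n : ℕ) : Path X := fun k => if k < n then ω k else y k

theorem splice_eventuallyEq (ω y : Path X) (n : ℕ) : splice ω y n =ᶠ[atTop] y := by
  filter_upwards [eventually_ge_atTop n] with k hk using if_neg hk.not_gt

theorem eventually_forall_splice_mem [TopologicalSpace X] {ω : Path X} {U : Set (Path X)}
    (hU : U ∈ 𝓝 ω) : ∀ᶠ n in atTop, ∀ y, splice ω y n ∈ U := by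
  obtain ⟨V, hVU, hV, hωV⟩ := mem_nhds_iff.1 hU
  obtain ⟨I, u, hu, hsub⟩ := isOpen_pi_iff.1 hV ω hωV
  filter_upwards [eventually_gt_atTop (I.sup id)] with n hn y
  refine hVU (hsub fun i hi => ?_)
  have hin : i < n := (Finset.le_sup (f := id) hi).trans_lt hn
  simpa only [splice, hin, if_true] using (hu i hi).2

theorem exists_pairwise_not_eventuallyEq (ι X : Type*) [Countable ι] [Nontrivial X] :
    ∃ y : ι → Path X, Pairwise fun i j => ¬ y i =ᶠ[atTop] y j := by
  classical
  obtain ⟨a, b, hab⟩ := exists_pair_ne X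
  obtain ⟨e, he⟩ := Countable.exists_injective_nat ι
  refine ⟨fun i k => if k.unpair.1 = e i then a else b, fun i j hij heq => ?_⟩
  obtain ⟨n, hn⟩ := eventually_atTop.1 heq
  have h := hn (Nat.pair (e i) n) (Nat.right_le_pair _ _)
  simp [he.ne hij, hab] at h

theorem measurableSet_setOf_eventuallyEq [TopologicalSpace X] [T1Space X]
    [MeasurableSpace (Path X)] [OpensMeasurableSpace (Path X)] (y : Path X) :
    MeasurableSet {η : Path X | η =ᶠ[atTop] y} := by
  have h : {η : Path X | η =ᶠ[atTop] y} = ⋃ n, ⋂ k ≥ n, (fun η : Path X => η k) ⁻¹' {y k} := by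
    ext η
    simp [EventuallyEq, eventually_atTop]
  rw [h]
  exact .iUnion fun n => (isClosed_biInter fun k _ =>
    isClosed_singleton.preimage (continuous_apply k)).measurableSet

theorem card_filter_range_div_lt {n : ℕ} (hn : 0 < n) {t : ℝ} (ht : t ≤ 1) :
    ((Finset.range n).filter fun k : ℕ => (k / n : ℝ) < t).card = ⌈t * n⌉₊ := by
  have hn' : (0 : ℝ) < n := Nat.cast_pos.2 hn
  have hceil : ⌈t * n⌉₊ ≤ n := Nat.ceil_le.2 (mul_le_of_le_one_left hn'.le ht)
  rw [← Finset.card_range ⌈t * n⌉₊]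
  congr 1
  ext k
  simp only [Finset.mem_filter, Finset.mem_range, div_lt_iff₀ hn', Nat.lt_ceil]
  exact ⟨And.right, fun h => ⟨(Nat.lt_ceil.2 h).trans_le hceil, h⟩⟩

/-- The uniform distribution on the splices at time `n` of `ω` with the paths `y (k / (n + 1))`,
`k ≤ n`. -/
def spliceEmpirical [MeasurableSpace (Path X)] (y : ℚ → Path X) (ω : Path X) (n : ℕ) :
    FinAddProb (Path X) :=
  .empirical (Finset.range (n + 1)) Finset.nonempty_range_add_one
    fun k => splice ω (y (k / (n + 1 : ℕ))) n

theorem spliceEmpirical_prob_eq_one [MeasurableSpace (Path X)] {y : ℚ → Path X} {ω : Path X}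
    {n : ℕ} {E : Event (Path X)} (h : ∀ z, splice ω z n ∈ E.1) :
    (spliceEmpirical y ω n).prob E = 1 := by
  simp [spliceEmpirical, FinAddProb.empirical, h, Nat.cast_add_one_ne_zero]

section TailEvent

variable [TopologicalSpace X] [T1Space X] [MeasurableSpace (Path X)]
  [OpensMeasurableSpace (Path X)]

/-- The paths that eventually agree with some `y q`, `q < t`: an increasing chain of events,
none of which is affected by changing finitely many coordinates of a path. -/
def tailEvent (y : ℚ → Path X) (t : ℝ) : Event (Path X) :=
  ⟨⋃ (q : ℚ) (_ : (q : ℝ) < t), {η | η =ᶠ[atTop] y q},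
    .iUnion fun q => .iUnion fun _ => measurableSet_setOf_eventuallyEq (y q)⟩

theorem monotone_tailEvent (y : ℚ → Path X) : Monotone (tailEvent y) := fun _ _ hst =>
  iUnion_mono fun _ => iUnion_mono' fun hq => ⟨hq.trans_le hst, Subset.rfl⟩

theorem splice_mem_tailEvent_iff {y : ℚ → Path X} (hy : Pairwise fun p q => ¬ y p =ᶠ[atTop] y q)
    {ω : Path X} {q : ℚ} {n : ℕ} {t : ℝ} :
    splice ω (y q) n ∈ tailEvent y t ↔ (q : ℝ) < t := by
  have htail (p : ℚ) : splice ω (y q) n =ᶠ[atTop] y p ↔ q = p :=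
    ⟨fun h => hy.eq (not_not.2 ((splice_eventuallyEq ω (y q) n).symm.trans h)),
      fun h => h ▸ splice_eventuallyEq ω (y q) n⟩
  change _ ∈ (tailEvent y t).1 ↔ _
  simp [tailEvent, htail]

theorem spliceEmpirical_prob_tailEvent {y : ℚ → Path X}
    (hy : Pairwise fun p q => ¬ y p =ᶠ[atTop] y q) (ω : Path X) (n : ℕ) {t : ℝ} (ht : t ≤ 1) :
    (spliceEmpirical y ω n).prob (tailEvent y t) = ⌈t * (n + 1 : ℕ)⌉₊ / (n + 1 : ℕ) := by
  classical
  rw [← card_filter_range_div_lt n.succ_pos ht]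
  simp [spliceEmpirical, FinAddProb.empirical, indicator_apply, splice_mem_tailEvent_iff hy,
    Finset.sum_boole]

theorem exists_isUniformAlong_tailEvent {y : ℚ → Path X}
    (hy : Pairwise fun p q => ¬ y p =ᶠ[atTop] y q) (ω : Path X) :
    ∃ m : FinAddProb (Path X), m.IsUniformAlong (tailEvent y) ∧
      ∀ E : Event (Path X), E.1 ∈ 𝓝 ω → m.prob E = 1 := by
  obtain ⟨m, hm⟩ := FinAddProb.exists_forall_tendsto (hyperfilter ℕ) (spliceEmpirical y ω)
  refine ⟨m, fun t ht => ?_, fun E hE => ?_⟩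
  · have hlim : Tendsto (fun n : ℕ => (⌈t * (n + 1 : ℕ)⌉₊ / (n + 1 : ℕ) : ℝ)) atTop (𝓝 t) :=
      (tendsto_nat_ceil_mul_div_atTop ht.1).comp
        (tendsto_natCast_atTop_atTop.comp (tendsto_add_atTop_nat 1))
    refine tendsto_nhds_unique (hm _) ((hlim.mono_left Nat.hyperfilter_le_atTop).congr fun n => ?_)
    exact (spliceEmpirical_prob_tailEvent hy ω n ht.2).symm
  · refine tendsto_nhds_unique (hm E) (tendsto_const_nhds.congr' ?_)
    filter_upwards [(eventually_forall_splice_mem hE).filter_mono Nat.hyperfilter_le_atTop]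
      with n hn using (spliceEmpirical_prob_eq_one hn).symm

end TailEvent

end Paths

section Manipulation

variable {X : Type*} [MetricSpace X] [MeasurableSpace (Path X)] [OpensMeasurableSpace (Path X)]

/-- A cylinder, regarded as an event. -/
def Cyl.toEvent (C : Cyl X) : Event (Path X) :=
  ⟨C.1, let ⟨ω, t, h⟩ := C.2; h ▸ measurableSet_cylinder ω t⟩

theorem FinAddProb.StronglyNonatomic.exists_uncond_eq [Nonempty X] {m : FinAddProb (Path X)}
    (hm : m.StronglyNonatomic) : ∃ P : CondOpinion X, P.uncond = m := by
  obtain ⟨κ, hκ_top, hκ_self, hκ_chain⟩ := m.exists_full_conditional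
  refine ⟨⟨⟨fun C => κ C.toEvent, fun ω t => ?_, fun ω t n E => ?_⟩, ?_⟩, hκ_top⟩
  · exact hκ_self (cylEvent ω t) ⟨ω, PiNat.self_mem_cylinder ω t⟩
  · exact hκ_chain (cylEvent ω t) (cylEvent ω (t + n)) E
      (PiNat.cylinder_anti ω (Nat.le_add_right t n))
  · change (κ ⊤).StronglyNonatomic
    rwa [hκ_top]

theorem Strategy.prob_eq_sum_indicator [Nonempty X] (ζ : Strategy X) (S : Set (CondOpinion X)) :
    ζ.prob S = ζ.weight.sum fun P a => a * S.indicator 1 P := by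
  classical
  simp [Strategy.prob, Finset.sum_filter, Finsupp.sum, indicator_apply]

theorem Test.canBeManipulated_of_forall_lt_prob_compl [Nontrivial X] (T : Test X) {c : ℝ}
    (hT : ∀ P : CondOpinion X, c < P.uncond.prob (openEvent (T P))ᶜ) :
    T.CanBeManipulated c := by
  obtain ⟨y, hy⟩ := exists_pairwise_not_eventuallyEq ℚ X
  obtain ⟨w, hw, hw_sum, hw_lt⟩ := FinAddProb.exists_finsupp_forall_isUniformAlong_lt_sum
    (A := tailEvent y) (E := fun P => (openEvent (T P))ᶜ) (c := c)
    ((exists_isUniformAlong_tailEvent hy (Classical.arbitrary _)).imp fun _ => And.left)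
    (fun m hm => by
      obtain ⟨P, rfl⟩ := (hm.stronglyNonatomic (monotone_tailEvent y)).exists_uncond_eq
      exact ⟨P, hT P⟩)
  refine ⟨⟨w, hw, hw_sum⟩, fun ω => ?_⟩
  obtain ⟨m, hm, hm_near⟩ := exists_isUniformAlong_tailEvent hy ω
  rw [Strategy.prob_eq_sum_indicator]
  refine (hw_lt m hm).le.trans (Finset.sum_le_sum fun P _ =>
    mul_le_mul_of_nonneg_left ?_ (hw P))
  by_cases hω : ω ∈ T P
  · have hnear : m.prob (openEvent (T P)) = 1 := hm_near _ ((T P).isOpen.mem_nhds hω)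
    simp [m.prob_compl, hnear, hω]
  · simp [hω, m.prob_le_one]

end Manipulation

end OpinionTest

end

theorem theorem5_general {X : Type*} [MetricSpace X] [Nontrivial X]
    [MeasurableSpace (OpinionTest.Path X)] [OpensMeasurableSpace (OpinionTest.Path X)]
    (ε : ℝ) (T : OpinionTest.Test X) (hT : T.ControlsTypeI Set.univ ε) (δ : ℝ) (hδ0 : 0 < δ) :
    T.CanBeManipulated (1 - ε - δ) := by
  refine T.canBeManipulated_of_forall_lt_prob_compl fun P => ?_
  rw [P.uncond.prob_compl]
  linarith [hT P (Set.mem_univ P)]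

/-- `Σ` is the given `MeasurableSpace` structure on the paths; `OpensMeasurableSpace` says that it
contains all open sets. -/
theorem theorem5 {X : Type*} [MetricSpace X] [TopologicalSpace.SeparableSpace X] [Nontrivial X]
    [MeasurableSpace (OpinionTest.Path X)] [OpensMeasurableSpace (OpinionTest.Path X)]
    (ε : ℝ) (hε0 : 0 ≤ ε) (hε1 : ε < 1)
    (T : OpinionTest.Test X) (hT : T.ControlsTypeI Set.univ ε)
    (δ : ℝ) (hδ0 : 0 < δ) (hδ1 : δ ≤ 1 - ε) :
    T.CanBeManipulated (1 - ε - δ) :=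
  theorem5_general ε T hT δ hδ0
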